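/- Let $\tau\le t$ be natural numbers. For $\tau\le i\le t$ let $\Omega_i>0$ and $\ell(l_i)>0$ be constants, and let $\phi_\tau,\dots,\phi_t$ be independent (not necessarily identically distributed) real random variables on a probability space, $\phi_i$ being exponentially distributed with mean $\ell(l_i)$ (so that $\Omega_i\phi_i$ is exponential with mean $\Omega_i\ell(l_i)$). Put $N=t-\tau+1$, $\xi_{\tau,t}=\prod_{i=\tau}^{t}\Omega_i\phi_i$ and $\bar\xi_{\tau,t}=\prod_{i=\tau}^{t}\Omega_i\,\ell(l_i)$. For $x>0$ and real $b_1,\dots,b_N$ let $$G^{N,0}_{0,N}\left[x\,\middle|\,b_1,\dots,b_N\right]=\frac{1}{2\pi \mathrm{i}}\int_{\sigma-\mathrm{i}\infty}^{\sigma+\mathrm{i}\infty}\ \prod_{j=1}^{N}\Gamma(b_j-s)\;x^{s}\,ds ,\qquad \sigma<\min_j b_j ,$$ be the Meijer $G$-function. Then, for the two parameter vectors occurring below and every $x>0$, this integral converges absolutely for each such $\sigma$, with a value independent of $\sigma$, and the following hold. (i) The cumulative distribution function $F_{\xi_{\tau,t}}(\xi)=\Pr[\xi_{\tau,t}<\xi]=\Pr[\xi_{\tau,t}\le\xi]$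 is $$F_{\xi_{\tau,t}}(\xi)=1-G^{N,0}_{0,N}\left[\frac{\xi}{\bar\xi_{\tau,t}}\,\middle|\,\underbrace{1,\dots,1}_{N-1},0\right]\quad(\xi>0),\qquad F_{\xi_{\tau,t}}(\xi)=0\quad(\xi\le 0).$$ (ii) $\xi_{\tau,t}$ has a probability density function with respect to Lebesgue measure, and (up to equality almost everywhere) it is the nonnegative function $$f_{\xi_{\tau,t}}(\xi)=\frac{1}{\bar\xi_{\tau,t}}\,G^{N,0}_{0,N}\left[\frac{\xi}{\bar\xi_{\tau,t}}\,\middle|\,\underbrace{0,\dots,0}_{N}\right]\quad(\xi>0),\qquad f_{\xi_{\tau,t}}(\xi)=0\quad(\xi\le 0).$$ -/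

import Mathlib

open MeasureTheory ProbabilityTheory

/-- The integrand of the Meijer G-function `G^{m,n}_{p,q}[z | a ; b]`, as a function of `s`:
`∏_{j ≤ m} Γ(b_j - s) ∏_{j ≤ n} Γ(1 - a_j + s) z ^ s` divided by
`∏_{m < j ≤ q} Γ(1 - b_j + s) ∏_{n < j ≤ p} Γ(a_j - s)`.
The reciprocal of `Γ` is entire and vanishes at the poles of `Γ`, which agrees with
`(Complex.Gamma w)⁻¹ = 0` there. -/
noncomputable def meijerGIntegrand (m n : ℕ) {p q : ℕ} (a : Fin p → ℂ) (b : Fin q → ℂ)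
    (z s : ℂ) : ℂ :=
  (∏ j : Fin q, if (j : ℕ) < m then Complex.Gamma (b j - s) else (Complex.Gamma (1 - b j + s))⁻¹) *
    (∏ j : Fin p, if (j : ℕ) < n then Complex.Gamma (1 - a j + s) else (Complex.Gamma (a j - s))⁻¹) *
    z ^ s

/-- The upward vertical line `Re s = σ` has all poles of `Γ(b_j - s)`, `j ≤ m`, on its right and
all poles of `Γ(1 - a_j + s)`, `j ≤ n`, on its left. -/
def MeijerGSeparates (m n : ℕ) {p q : ℕ} (a : Fin p → ℂ) (b : Fin q → ℂ) (σ : ℝ) : Prop :=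
  (∀ j : Fin q, (j : ℕ) < m → σ < (b j).re) ∧ (∀ j : Fin p, (j : ℕ) < n → (a j).re - 1 < σ)

/-- The Mellin-Barnes integral `(1 / (2 π i)) ∫ (integrand) ds` along the line `Re s = σ` from
`σ - i ∞` to `σ + i ∞` (with `s = σ + i y`, `ds = i dy`). -/
noncomputable def meijerGLineIntegral (m n : ℕ) {p q : ℕ} (a : Fin p → ℂ) (b : Fin q → ℂ)
    (z : ℂ) (σ : ℝ) : ℂ :=
  (1 / (2 * (Real.pi : ℂ))) * ∫ y : ℝ, meijerGIntegrand m n a b z ((σ : ℂ) + (y : ℂ) * Complex.I)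

/-- The Mellin-Barnes integral defining `G^{m,n}_{p,q}[z | a ; b]` makes sense: there is a
separating vertical line, and along each such line the integral converges absolutely, with a value
that does not depend on the line. -/
def MeijerGWellDefined (m n : ℕ) {p q : ℕ} (a : Fin p → ℂ) (b : Fin q → ℂ) (z : ℂ) : Prop :=
  (∃ σ : ℝ, MeijerGSeparates m n a b σ) ∧
  (∀ σ : ℝ, MeijerGSeparates m n a b σ →
    Integrable (fun y : ℝ => meijerGIntegrand m n a b z ((σ : ℂ) + (y : ℂ) * Complex.I))) ∧
  (∀ σ σ' : ℝ, MeijerGSeparates m n a b σ → MeijerGSeparates m n a b σ' →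
    meijerGLineIntegral m n a b z σ = meijerGLineIntegral m n a b z σ')

open Classical in
/-- The Meijer G-function `G^{m,n}_{p,q}[z | a ; b]`, as the Mellin-Barnes integral along a vertical
line that separates the two families of poles (`0` by convention if there is no such line). -/
noncomputable def meijerG (m n : ℕ) {p q : ℕ} (a : Fin p → ℂ) (b : Fin q → ℂ) (z : ℂ) : ℂ :=
  if h : ∃ σ : ℝ, MeijerGSeparates m n a b σ then meijerGLineIntegral m n a b z h.choose else 0

/-! After rescaling, `ξ` is `ξbar` times a product of independent standard exponentials. Split off
one factor and let `V` be the product of the other `n = t - τ`. Conditionally on `W = ξbar * V`, the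
variable `ξ` is exponential with mean `W`. Its tail at `x > 0` is therefore `E[exp(-x/W)]` and its
density is `E[W⁻¹ exp(-x/W)]` (`cdf_map_mul_exp`, `map_mul_exp_eq_withDensity`).

Both are averages `E[V^(β-1) exp(-y/V)]` with `y = x/ξbar`: `β = 1` for the tail and, up to the
factor `1/ξbar`, `β = 0` for the density. Mellin inversion of `exp(-u)` writes the exponential as an
integral of `Γ(-s) u^s` over a vertical line. Fubini moves the expectation inside, and `E[V^(β-1-s)]
= Γ(β-s)^n` gives the Meijer integrand (`integral_mellin_average`, `meijerG_eq_integral`). The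
average does not involve the line, so the value of the integral does not depend on it. -/

/-! ### The Gamma function on vertical lines and Mellin inversion. -/

lemma continuous_Gamma_vertical {c : ℝ} (hc : 0 < c) :
    Continuous fun y : ℝ => Complex.Gamma ((c : ℂ) + (y : ℂ) * Complex.I) := by
  rw [continuous_iff_continuousAt]
  intro y
  have h : ContinuousAt Complex.Gamma ((c : ℂ) + (y : ℂ) * Complex.I) := by
    refine (Complex.differentiableAt_Gamma _ fun m hm => ?_).continuousAt
    have := congrArg Complex.re hm
    simp at this
    have hm0 : (0 : ℝ) ≤ m := m.cast_nonneg
    linarith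
  exact ContinuousAt.comp (f := fun y : ℝ => (c : ℂ) + (y : ℂ) * Complex.I) h (by fun_prop)

lemma norm_Gamma_le_Gamma_re {s : ℂ} (hs : 0 < s.re) :
    ‖Complex.Gamma s‖ ≤ Real.Gamma s.re := by
  rw [Complex.Gamma_eq_integral hs, Real.Gamma_eq_integral hs, Complex.GammaIntegral]
  refine (norm_integral_le_integral_norm _).trans (le_of_eq ?_)
  refine setIntegral_congr_fun measurableSet_Ioi fun x (hx : 0 < x) => ?_
  simp [Complex.norm_cpow_eq_rpow_re_of_pos hx, Complex.norm_exp]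

/-- Two uses of the functional equation suffice: `Γ(s) = Γ(s+2) / (s(s+1))`, where the numerator is
bounded on the line and the denominator grows quadratically in `y`. -/
lemma integrable_Gamma_vertical {c : ℝ} (hc : 0 < c) :
    Integrable fun y : ℝ => Complex.Gamma ((c : ℂ) + (y : ℂ) * Complex.I) := by
  -- With `d ≤ c` and `d ≤ 1`, `‖s‖² = c² + y² ≥ d² (1 + y²)`, so one constant serves for small and
  -- large `c`.
  set d := min c 1
  have hd : 0 < d := lt_min hc one_pos
  have hdc : d ≤ c := min_le_left _ _
  have hd1 : d ≤ 1 := min_le_right _ _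
  refine Integrable.mono' (g := fun y : ℝ => Real.Gamma (c + 2) / d ^ 2 * (1 + y ^ 2)⁻¹)
    (integrable_inv_one_add_sq.const_mul _)
    (continuous_Gamma_vertical hc).aestronglyMeasurable (.of_forall fun y => ?_)
  set s : ℂ := (c : ℂ) + (y : ℂ) * Complex.I with hs
  have hre : s.re = c := by simp [hs]
  have him : s.im = y := by simp [hs]
  have h0 : s ≠ 0 := fun h => by simp [h] at hre; linarith
  have h1 : s + 1 ≠ 0 := fun h => by
    have := congrArg Complex.re h
    simp [hre] at this; linarith
  have hG : Complex.Gamma (s + 2) = (s + 1) * (s * Complex.Gamma s) := by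
    rw [← Complex.Gamma_add_one s h0, ← Complex.Gamma_add_one _ h1]
    ring_nf
  have hle : ‖Complex.Gamma (s + 2)‖ ≤ Real.Gamma (c + 2) := by
    have := norm_Gamma_le_Gamma_re (s := s + 2) (by simp [hre]; linarith)
    simpa [hre] using this
  have hb : d ^ 2 * (1 + y ^ 2) ≤ ‖s + 1‖ * ‖s‖ := by
    have e0 : ‖s‖ ^ 2 = c ^ 2 + y ^ 2 := by
      rw [Complex.sq_norm, Complex.normSq_apply, hre, him]; ring
    have e1 : ‖s + 1‖ ^ 2 = (c + 1) ^ 2 + y ^ 2 := by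
      rw [Complex.sq_norm, Complex.normSq_apply]; simp [hre, him]; ring
    have hss : ‖s‖ ≤ ‖s + 1‖ := by
      apply le_of_sq_le_sq _ (norm_nonneg _)
      rw [e0, e1]; nlinarith
    calc d ^ 2 * (1 + y ^ 2) ≤ ‖s‖ * ‖s‖ := by
          rw [← sq, e0]
          have : d ^ 2 ≤ c ^ 2 := by gcongr
          have : d ^ 2 ≤ 1 := by nlinarith
          nlinarith [sq_nonneg y]
      _ ≤ _ := by gcongr
  rw [hG, norm_mul, norm_mul] at hle
  rw [div_mul_eq_mul_div, le_div_iff₀ (by positivity), ← div_eq_mul_inv,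
    le_div_iff₀ (by positivity)]
  calc ‖Complex.Gamma s‖ * d ^ 2 * (1 + y ^ 2) = d ^ 2 * (1 + y ^ 2) * ‖Complex.Gamma s‖ := by ring
    _ ≤ ‖s + 1‖ * ‖s‖ * ‖Complex.Gamma s‖ := by gcongr
    _ ≤ _ := by linarith

lemma mellin_exp_neg {s : ℂ} (hs : 0 < s.re) :
    mellin (fun u : ℝ => ((Real.exp (-u) : ℝ) : ℂ)) s = Complex.Gamma s := by
  rw [Complex.Gamma_eq_integral hs, Complex.GammaIntegral, mellin]
  simp [mul_comm]

/-- Mellin inversion of the exponential function. -/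
lemma integral_Gamma_mul_cpow {σ x : ℝ} (hσ : σ < 0) (hx : 0 < x) :
    (1 / (2 * (Real.pi : ℂ))) * ∫ y : ℝ, Complex.Gamma (-((σ : ℂ) + (y : ℂ) * Complex.I)) *
      (x : ℂ) ^ ((σ : ℂ) + (y : ℂ) * Complex.I) = (Real.exp (-x) : ℝ) := by
  have hc : 0 < -σ := by linarith
  have hre : ∀ y : ℝ, 0 < (((-σ : ℝ) : ℂ) + (y : ℂ) * Complex.I).re := fun y => by simpa using hσ
  have key := mellinInv_mellin_eq (-σ) (fun u : ℝ => ((Real.exp (-u) : ℝ) : ℂ)) hx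
    (by
      have := Complex.GammaIntegral_convergent (s := ((-σ : ℝ) : ℂ)) (by simpa using hσ)
      simpa [MellinConvergent, mul_comm] using this)
    (by
      refine (integrable_Gamma_vertical hc).congr (.of_forall fun y => ?_)
      exact (mellin_exp_neg (hre y)).symm)
    (by fun_prop)
  -- Mellin inversion uses `x^(-s)` on the line `Re s = -σ`; the reflection `y ↦ -y` turns this into
  -- `x^s` on `Re s = σ`.
  rw [← key, mellinInv, ← integral_neg_eq_self]
  simp_rw [fun y : ℝ => mellin_exp_neg (hre y)]
  rw [Complex.real_smul]
  push_cast
  congr 2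
  ext y
  rw [smul_eq_mul, mul_comm]
  ring_nf

/-- Apply Mellin inversion at `x / X ω`, multiply by `X ω ^ (-k)` and integrate over `ω`. The
exponent `k` lets one argument serve both the tail and the density. -/
lemma integral_mellin_average {S : Type*} [MeasurableSpace S] {μ : Measure S}
    [SFinite μ] {X : S → ℝ} (hX : AEMeasurable X μ) (hpos : ∀ᵐ ω ∂μ, 0 < X ω)
    {σ k x : ℝ} (hσ : σ < 0) (hx : 0 < x) (hint : Integrable (fun ω => X ω ^ (-σ - k)) μ) :
    Integrable (fun y : ℝ => (∫ ω, (X ω : ℂ) ^ (-((σ : ℂ) + (y : ℂ) * Complex.I) - k) ∂μ) *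
      (Complex.Gamma (-((σ : ℂ) + (y : ℂ) * Complex.I)) *
        (x : ℂ) ^ ((σ : ℂ) + (y : ℂ) * Complex.I))) ∧
    (1 / (2 * (Real.pi : ℂ))) * ∫ y : ℝ,
      (∫ ω, (X ω : ℂ) ^ (-((σ : ℂ) + (y : ℂ) * Complex.I) - k) ∂μ) *
      (Complex.Gamma (-((σ : ℂ) + (y : ℂ) * Complex.I)) *
        (x : ℂ) ^ ((σ : ℂ) + (y : ℂ) * Complex.I)) =
      ((∫ ω, X ω ^ (-k) * Real.exp (-(x / X ω)) ∂μ : ℝ) : ℂ) := by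
  have hx0 : (x : ℂ) ≠ 0 := by exact_mod_cast hx.ne'
  have hcG : Continuous fun y : ℝ => Complex.Gamma (-((σ : ℂ) + (y : ℂ) * Complex.I)) := by
    have := (continuous_Gamma_vertical (c := -σ) (by linarith)).comp continuous_neg
    refine this.congr fun y => ?_
    simp only [Function.comp]
    push_cast
    ring_nf
  have hiG : Integrable fun y : ℝ => Complex.Gamma (-((σ : ℂ) + (y : ℂ) * Complex.I)) := by
    refine (integrable_Gamma_vertical (c := -σ) (by linarith)).comp_neg.congr
      (.of_forall fun y => ?_)
    push_cast
    ring_nf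
  set F : S → ℝ → ℂ := fun ω y => (X ω : ℂ) ^ (-((σ : ℂ) + (y : ℂ) * Complex.I) - k) *
      (Complex.Gamma (-((σ : ℂ) + (y : ℂ) * Complex.I)) *
        (x : ℂ) ^ ((σ : ℂ) + (y : ℂ) * Complex.I)) with hF
  -- The modulus of a complex power of a positive base depends only on the real part of the
  -- exponent, so `‖F‖` is a product of a function of `ω` and a function of `y`.
  have hFi : Integrable (Function.uncurry F) (μ.prod volume) := by
    refine Integrable.mono' (hint.mul_prod (hiG.norm.mul_const (x ^ σ))) ?_ ?_
    · refine AEMeasurable.aestronglyMeasurable ?_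
      have h1 : AEMeasurable (fun z : S × ℝ => (X z.1 : ℂ)) (μ.prod volume) :=
        Complex.measurable_ofReal.comp_aemeasurable hX.comp_fst
      have h2 : Measurable fun y : ℝ => Complex.Gamma (-((σ : ℂ) + (y : ℂ) * Complex.I)) :=
        hcG.measurable
      have h3 : Measurable fun z : S × ℝ =>
          Complex.Gamma (-((σ : ℂ) + (z.2 : ℂ) * Complex.I)) := h2.comp measurable_snd
      exact (h1.pow (by fun_prop)).mul (h3.aemeasurable.mul (by fun_prop))
    · have hp : ∀ᵐ z ∂(μ.prod (volume : Measure ℝ)), 0 < X z.1 :=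
        Measure.quasiMeasurePreserving_fst.ae hpos
      filter_upwards [hp] with z hz
      simp only [Function.uncurry, hF, norm_mul]
      rw [Complex.norm_cpow_eq_rpow_re_of_pos hz, Complex.norm_cpow_eq_rpow_re_of_pos hx]
      simp
  have hFint : ∀ y, ∫ ω, F ω y ∂μ =
      (∫ ω, (X ω : ℂ) ^ (-((σ : ℂ) + (y : ℂ) * Complex.I) - k) ∂μ) *
      (Complex.Gamma (-((σ : ℂ) + (y : ℂ) * Complex.I)) *
        (x : ℂ) ^ ((σ : ℂ) + (y : ℂ) * Complex.I)) := fun y => integral_mul_const _ _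
  refine ⟨hFi.integral_prod_right.congr (.of_forall hFint), ?_⟩
  simp_rw [← hFint]
  rw [← integral_integral_swap hFi, ← integral_const_mul, ← integral_complex_ofReal]
  refine integral_congr_ae ?_
  filter_upwards [hpos] with ω hω
  have hω0 : (X ω : ℂ) ≠ 0 := by exact_mod_cast hω.ne'
  have hprod : ∀ y : ℝ, F ω y = (X ω : ℂ) ^ (-k : ℂ) *
      (Complex.Gamma (-((σ : ℂ) + (y : ℂ) * Complex.I)) *
        ((x / X ω : ℝ) : ℂ) ^ ((σ : ℂ) + (y : ℂ) * Complex.I)) := fun y => by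
    simp only [hF]
    rw [div_eq_mul_inv, Complex.ofReal_mul,
      Complex.mul_cpow_ofReal_nonneg hx.le (inv_nonneg.2 hω.le), Complex.ofReal_inv,
      Complex.inv_cpow_ofReal_nonneg hω.le, ← Complex.cpow_neg, sub_eq_neg_add, Complex.cpow_add _ _ hω0]
    ring
  simp_rw [hprod]
  rw [integral_const_mul, mul_left_comm, integral_Gamma_mul_cpow hσ (div_pos hx hω)]
  rw [Complex.ofReal_mul, Complex.ofReal_cpow hω.le, Complex.ofReal_neg]

/-- The Meijer function `G^{n+1,0}_{0,n+1}[x | β, …, β, 0]` as an average of exponentials over a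
positive random variable whose complex moments are powers of the Gamma function. -/
lemma meijerG_eq_integral {S : Type*} [MeasurableSpace S] {μ : Measure S}
    [SFinite μ] {X : S → ℝ} (hX : AEMeasurable X μ) (hpos : ∀ᵐ ω ∂μ, 0 < X ω) {n : ℕ}
    (hint : ∀ r : ℝ, -1 < r → Integrable (fun ω => X ω ^ r) μ)
    (hmom : ∀ w : ℂ, -1 < w.re → ∫ ω, (X ω : ℂ) ^ w ∂μ = Complex.Gamma (1 + w) ^ n)
    {β : ℝ} (hβ : 0 ≤ β) (a : Fin 0 → ℂ) {x : ℝ} (hx : 0 < x) :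
    MeijerGWellDefined (n + 1) 0 a
      (Fin.snoc (α := fun _ => ℂ) (fun _ : Fin n => (β : ℂ)) (0 : ℂ)) (x : ℂ) ∧
    meijerG (n + 1) 0 a
      (Fin.snoc (α := fun _ => ℂ) (fun _ : Fin n => (β : ℂ)) (0 : ℂ)) (x : ℂ) =
      ((∫ ω, X ω ^ (β - 1) * Real.exp (-(x / X ω)) ∂μ : ℝ) : ℂ) := by
  set b : Fin (n + 1) → ℂ := Fin.snoc (α := fun _ => ℂ) (fun _ : Fin n => (β : ℂ)) (0 : ℂ) with hb
  -- Since `β ≥ 0`, the last parameter `0` is the binding one.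
  have hsep : ∀ σ : ℝ, MeijerGSeparates (n + 1) 0 a b σ ↔ σ < 0 := fun σ => by
    refine ⟨fun h => by simpa [hb] using h.1 (Fin.last n) (by simp), fun h => ⟨fun j _ => ?_,
      fun j => j.elim0⟩⟩
    induction j using Fin.lastCases with
    | last => simpa [hb] using h
    | cast j => simpa [hb] using h.trans_le hβ
  -- The choice `k = 1 - β` makes the moment of order `-s - k` equal to `Γ(β - s)^n`.
  have hmeq : ∀ σ y : ℝ, σ < 0 → meijerGIntegrand (n + 1) 0 a b x ((σ : ℂ) + (y : ℂ) * Complex.I) =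
      (∫ ω, (X ω : ℂ) ^ (-((σ : ℂ) + (y : ℂ) * Complex.I) - ((1 - β : ℝ) : ℂ)) ∂μ) *
      (Complex.Gamma (-((σ : ℂ) + (y : ℂ) * Complex.I)) *
        (x : ℂ) ^ ((σ : ℂ) + (y : ℂ) * Complex.I)) := fun σ y hσ => by
    rw [hmom _ (by simp; linarith), meijerGIntegrand]
    simp only [Fin.is_lt, if_true, Finset.univ_eq_empty, Finset.prod_empty, mul_one]
    rw [Fin.prod_univ_castSucc]
    simp only [hb, Fin.snoc_castSucc, Fin.snoc_last, Finset.prod_const, Finset.card_univ,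
      Fintype.card_fin]
    push_cast
    ring_nf
  have main := fun (σ : ℝ) (hσ : σ < 0) => integral_mellin_average (k := 1 - β) hX hpos hσ hx
    (hint _ (by linarith))
  have hval : ∀ σ : ℝ, σ < 0 → meijerGLineIntegral (n + 1) 0 a b x σ =
      ((∫ ω, X ω ^ (β - 1) * Real.exp (-(x / X ω)) ∂μ : ℝ) : ℂ) := fun σ hσ => by
    rw [meijerGLineIntegral]
    simp_rw [hmeq σ _ hσ]
    rw [(main σ hσ).2, neg_sub]
  have hex : ∃ σ : ℝ, MeijerGSeparates (n + 1) 0 a b σ := ⟨-1, (hsep _).2 (by norm_num)⟩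
  refine ⟨⟨hex, fun σ hσ => ?_, fun σ σ' hσ hσ' => ?_⟩, ?_⟩
  · simp_rw [hmeq σ _ ((hsep σ).1 hσ)]
    exact (main σ ((hsep σ).1 hσ)).1
  · rw [hval σ ((hsep σ).1 hσ), hval σ' ((hsep σ').1 hσ')]
  · rw [meijerG, dif_pos hex]
    exact hval _ ((hsep _).1 hex.choose_spec)

/-! ### Positivity, scaling and complex moments of the exponential law. -/

lemma ae_pos_expMeasure {r : ℝ} : ∀ᵐ u ∂expMeasure r, 0 < u := by
  have h : expMeasure r (Set.Iic 0) = 0 := by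
    change volume.withDensity (exponentialPDF r) (Set.Iic 0) = 0
    rw [withDensity_apply _ measurableSet_Iic, setLIntegral_congr Iio_ae_eq_Iic.symm,
      lintegral_exponentialPDF_of_nonpos le_rfl]
  rw [ae_iff]
  simpa [Set.Iic] using h

lemma map_const_mul_expMeasure {c r : ℝ} (hc : 0 < c) (hr : 0 < r) :
    (expMeasure r).map (fun u => c * u) = expMeasure (r / c) := by
  have hrc := div_pos hr hc
  have := isProbabilityMeasure_expMeasure hr
  have := isProbabilityMeasure_expMeasure hrc
  have : IsProbabilityMeasure ((expMeasure r).map (fun u => c * u)) :=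
    Measure.isProbabilityMeasure_map (by fun_prop)
  refine Measure.eq_of_cdf _ _ ?_
  ext x
  have hpre : (fun u => c * u) ⁻¹' Set.Iic x = Set.Iic (x / c) := by
    ext u
    simp [le_div_iff₀' hc]
  rw [cdf_eq_real, map_measureReal_apply (by fun_prop) measurableSet_Iic, hpre, ← cdf_eq_real,
    cdf_expMeasure_eq hr, cdf_expMeasure_eq hrc]
  have : 0 ≤ x / c ↔ 0 ≤ x := by rw [le_div_iff₀ hc, zero_mul]
  simp only [this]
  congr 4
  ring

lemma integral_cpow_expMeasure_one {w : ℂ} (hw : -1 < w.re) :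
    ∫ u : ℝ, (u : ℂ) ^ w ∂expMeasure 1 = Complex.Gamma (1 + w) := by
  change ∫ u : ℝ, (u : ℂ) ^ w ∂volume.withDensity (exponentialPDF 1) = _
  have hm : Measurable (exponentialPDF 1) :=
    (measurable_exponentialPDFReal 1).ennreal_ofReal
  rw [integral_withDensity_eq_integral_toReal_smul hm (by simp [exponentialPDF]),
    Complex.Gamma_eq_integral (by simp; linarith), Complex.GammaIntegral,
    ← integral_indicator measurableSet_Ioi]
  refine integral_congr_ae ?_
  filter_upwards [Measure.ae_ne volume (0 : ℝ)] with u hu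
  rcases lt_or_gt_of_ne hu with h | h
  · simp [exponentialPDF_of_neg h, h.le]
  · rw [exponentialPDF_of_nonneg h.le, Set.indicator_of_mem (Set.mem_Ioi.2 h),
      ENNReal.toReal_ofReal (by positivity)]
    simp

/-! ### Complex moments of products of independent standard exponentials. -/

section products

variable {S : Type*} [MeasurableSpace S] {μ : Measure S} {ι : Type*} {U : ι → S → ℝ}

lemma ae_pos_prod_exp [Fintype ι] (hU : ∀ i, HasLaw (U i) (expMeasure 1) μ) (s : Finset ι) :
    ∀ᵐ ω ∂μ, 0 < ∏ i ∈ s, U i ω := by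
  have : ∀ᵐ ω ∂μ, ∀ i, 0 < U i ω := by
    rw [ae_all_iff]
    intro i
    have := ae_pos_expMeasure (r := 1)
    rw [← (hU i).map_eq] at this
    exact ae_of_ae_map (hU i).aemeasurable this
  filter_upwards [this] with ω h
  exact Finset.prod_pos fun i _ => h i

lemma ofReal_prod_cpow {f : ι → ℝ} (s : Finset ι) (hf : ∀ i ∈ s, 0 ≤ f i) (w : ℂ) :
    ((∏ i ∈ s, f i : ℝ) : ℂ) ^ w = ∏ i ∈ s, (f i : ℂ) ^ w := by
  classical
  induction s using Finset.induction_on with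
  | empty => simp
  | insert j s hj ih =>
    have h' : ∀ i ∈ s, 0 ≤ f i := fun i hi => hf i (Finset.mem_insert_of_mem hi)
    rw [Finset.prod_insert hj, Finset.prod_insert hj, Complex.ofReal_mul,
      Complex.mul_cpow_ofReal_nonneg (hf j (Finset.mem_insert_self j s)) (Finset.prod_nonneg h'),
      ih h']

lemma integral_prod_exp_cpow [Fintype ι] (hU : ∀ i, HasLaw (U i) (expMeasure 1) μ)
    (hind : iIndepFun U μ) (s : Finset ι) {w : ℂ} (hw : -1 < w.re) :
    ∫ ω, ((∏ i ∈ s, U i ω : ℝ) : ℂ) ^ w ∂μ = Complex.Gamma (1 + w) ^ s.card := by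
  classical
  have := hind.isProbabilityMeasure
  have hpow : Measurable fun u : ℝ => (u : ℂ) ^ w := by fun_prop
  -- Factors outside `s` are replaced by the constant `1`, so that independence of the whole family
  -- applies.
  have key := hind.integral_fun_prod_comp (𝕜 := ℂ)
    (f := fun i (u : ℝ) => if i ∈ s then (u : ℂ) ^ w else 1) (fun i => (hU i).aemeasurable)
    (fun i => by
      by_cases hi : i ∈ s
      · simpa [hi] using hpow.aestronglyMeasurable
      · simpa [hi] using aestronglyMeasurable_const)
  have hfac : ∀ i, ∫ ω, (if i ∈ s then (U i ω : ℂ) ^ w else 1) ∂μ =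
      if i ∈ s then Complex.Gamma (1 + w) else 1 := fun i => by
    split_ifs
    · rw [← integral_cpow_expMeasure_one hw]
      exact (hU i).integral_comp hpow.aestronglyMeasurable
    · simp
  simp only [hfac, Finset.prod_ite_mem, Finset.univ_inter, Finset.prod_const] at key
  rw [← key]
  have hp : ∀ᵐ ω ∂μ, ∀ i, 0 < U i ω := by
    rw [ae_all_iff]
    exact fun i => by simpa using ae_pos_prod_exp hU {i}
  refine integral_congr_ae ?_
  filter_upwards [hp] with ω h
  exact ofReal_prod_cpow s (fun i _ => (h i).le) w

lemma integrable_prod_exp_rpow [Fintype ι] (hU : ∀ i, HasLaw (U i) (expMeasure 1) μ)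
    (hind : iIndepFun U μ) (s : Finset ι) {r : ℝ} (hr : -1 < r) :
    Integrable (fun ω => (∏ i ∈ s, U i ω) ^ r) μ := by
  have h : Integrable (fun ω => ((∏ i ∈ s, U i ω : ℝ) : ℂ) ^ (r : ℂ)) μ := by
    -- The Bochner integral of a non-integrable function is `0`, while this one is a power of a
    -- Gamma value with positive real part, hence nonzero.
    refine Integrable.of_integral_ne_zero ?_
    rw [integral_prod_exp_cpow hU hind s (by simpa using hr)]
    refine pow_ne_zero _ (Complex.Gamma_ne_zero_of_re_pos ?_)
    simp
    linarith
  refine h.norm.congr ?_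
  filter_upwards [ae_pos_prod_exp hU s] with ω hω
  rw [Complex.norm_cpow_eq_rpow_re_of_pos hω, Complex.ofReal_re]

end products

/-! ### Mixtures of exponential laws. -/

section mixture

variable {S : Type*} [MeasurableSpace S] {μ : Measure S} [IsProbabilityMeasure μ] {W U : S → ℝ}

/-- The law of `W * U`, for `U` exponential and independent of `W > 0`, is a mixture of exponential
laws. -/
lemma map_mul_exp_apply (hW : AEMeasurable W μ) (hpos : ∀ᵐ ω ∂μ, 0 < W ω)
    (hU : HasLaw U (expMeasure 1) μ) (hind : IndepFun W U μ) {A : Set ℝ} (hA : MeasurableSet A) :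
    μ.map (fun ω => W ω * U ω) A = ∫⁻ ω, expMeasure (1 / W ω) A ∂μ := by
  have := isProbabilityMeasure_expMeasure one_pos
  have hm : Measurable fun p : ℝ × ℝ => p.1 * p.2 := by fun_prop
  have hmap : μ.map (fun ω => W ω * U ω) =
      ((μ.map W).prod (expMeasure 1)).map fun p => p.1 * p.2 := by
    rw [← hU.map_eq, ← hind.map_prod_eq_prod_map_map hW hU.aemeasurable,
      AEMeasurable.map_map_of_aemeasurable hm.aemeasurable (hW.prodMk hU.aemeasurable)]
    rfl
  rw [hmap, Measure.map_apply hm hA, Measure.prod_apply (hm hA),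
    lintegral_map' (measurable_measure_prodMk_left (hm hA)).aemeasurable hW]
  refine lintegral_congr_ae ?_
  filter_upwards [hpos] with ω hω
  rw [← map_const_mul_expMeasure hω one_pos, Measure.map_apply (by fun_prop) hA]
  rfl

lemma cdf_map_mul_exp (hW : AEMeasurable W μ) (hpos : ∀ᵐ ω ∂μ, 0 < W ω)
    (hU : HasLaw U (expMeasure 1) μ) (hind : IndepFun W U μ) (x : ℝ) :
    cdf (μ.map fun ω => W ω * U ω) x =
      if 0 ≤ x then 1 - ∫ ω, Real.exp (-(x / W ω)) ∂μ else 0 := by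
  have hmul : AEMeasurable (fun ω => W ω * U ω) μ := hW.mul hU.aemeasurable
  have := Measure.isProbabilityMeasure_map hmul
  have hcomp : ∀ᵐ ω ∂μ, expMeasure (1 / W ω) (Set.Iic x) =
      ENNReal.ofReal (if 0 ≤ x then 1 - Real.exp (-(x / W ω)) else 0) := by
    filter_upwards [hpos] with ω hω
    have hω' := one_div_pos.2 hω
    have := isProbabilityMeasure_expMeasure hω'
    rw [← ofReal_cdf, cdf_expMeasure_eq hω', one_div_mul_eq_div]
  rw [cdf_eq_real, measureReal_def, map_mul_exp_apply hW hpos hU hind measurableSet_Iic,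
    lintegral_congr_ae hcomp]
  split_ifs with hx
  · have hle : ∀ᵐ ω ∂μ, Real.exp (-(x / W ω)) ≤ 1 := by
      filter_upwards [hpos] with ω hω
      exact Real.exp_le_one_iff.2 (neg_nonpos.2 (div_nonneg hx hω.le))
    have hmeas : AEStronglyMeasurable (fun ω => Real.exp (-(x / W ω))) μ := by
      have : AEMeasurable (fun ω => Real.exp (-(x / W ω))) μ := by fun_prop
      exact this.aestronglyMeasurable
    have hi : Integrable (fun ω => Real.exp (-(x / W ω))) μ := by
      refine Integrable.mono' (integrable_const 1) hmeas ?_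
      filter_upwards [hle] with ω hω
      rwa [Real.norm_eq_abs, abs_of_pos (Real.exp_pos _)]
    have hnn : 0 ≤ᵐ[μ] fun ω => 1 - Real.exp (-(x / W ω)) := by
      filter_upwards [hle] with ω hω
      exact sub_nonneg.2 hω
    rw [← integral_eq_lintegral_of_nonneg_ae hnn ((integrable_const 1).sub hi).aestronglyMeasurable,
      integral_sub (integrable_const _) hi]
    simp
  · simp

/-- By Tonelli, the density of a mixture is the average of the densities. Measurability of `f`
follows from that of the average, with which it agrees off `x = 0`. -/
lemma map_mul_exp_eq_withDensity (hW : AEMeasurable W μ) (hpos : ∀ᵐ ω ∂μ, 0 < W ω)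
    (hU : HasLaw U (expMeasure 1) μ) (hind : IndepFun W U μ) {f : ℝ → ℝ}
    (hf : ∀ x, 0 < x → f x = ∫ ω, (W ω)⁻¹ * Real.exp (-(x / W ω)) ∂μ)
    (hf0 : ∀ x, x ≤ 0 → f x = 0) :
    AEMeasurable (fun x => ENNReal.ofReal (f x)) ∧
    μ.map (fun ω => W ω * U ω) = volume.withDensity fun x => ENNReal.ofReal (f x) := by
  have hjoint : AEMeasurable (fun p : S × ℝ => exponentialPDF (1 / W p.1) p.2)
      (μ.prod volume) := by
    simp only [exponentialPDF_eq]
    have hW1 : AEMeasurable (fun p : S × ℝ => W p.1) (μ.prod volume) := hW.comp_fst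
    have hset : MeasurableSet {p : S × ℝ | 0 ≤ p.2} := measurableSet_le measurable_const
      measurable_snd
    have h := (show AEMeasurable (fun p : S × ℝ =>
      1 / W p.1 * Real.exp (-(1 / W p.1 * p.2))) (μ.prod volume) by fun_prop).indicator hset
    refine h.ennreal_ofReal.congr (.of_forall fun p => ?_)
    simp [Set.indicator_apply]
  have hae : (fun x => ENNReal.ofReal (f x)) =ᵐ[volume]
      fun x => ∫⁻ ω, exponentialPDF (1 / W ω) x ∂μ := by
    filter_upwards [Measure.ae_ne volume (0 : ℝ)] with x hx
    rcases lt_or_gt_of_ne hx with h | h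
    · simp [hf0 x h.le, exponentialPDF_of_neg h]
    · have hnn : ∀ᵐ ω ∂μ, 0 ≤ (W ω)⁻¹ * Real.exp (-(x / W ω)) := by
        filter_upwards [hpos] with ω hω
        positivity
      have hi : Integrable (fun ω => (W ω)⁻¹ * Real.exp (-(x / W ω))) μ := by
        refine Integrable.mono' (integrable_const x⁻¹)
          (show AEMeasurable _ μ by fun_prop).aestronglyMeasurable ?_
        filter_upwards [hpos] with ω hω
        rw [Real.norm_eq_abs, abs_of_nonneg (by positivity), Real.exp_neg, ← div_eq_mul_inv,
          div_le_iff₀ (Real.exp_pos _)]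
        -- The bound `u ≤ exp u` at `u = x / W` dominates the integrand by `x⁻¹`, so no negative
        -- moment of `W` is needed.
        calc (W ω)⁻¹ = x⁻¹ * (x / W ω) := by field_simp
          _ ≤ x⁻¹ * Real.exp (x / W ω) := by
            gcongr
            linarith [Real.add_one_le_exp (x / W ω)]
      rw [hf x h, ofReal_integral_eq_lintegral_ofReal hi hnn]
      refine lintegral_congr fun ω => ?_
      rw [exponentialPDF_of_nonneg h.le, one_div, div_eq_inv_mul]
  refine ⟨hjoint.lintegral_prod_left'.congr hae.symm, ?_⟩
  rw [withDensity_congr_ae hae]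
  ext A hA
  rw [map_mul_exp_apply hW hpos hU hind hA, withDensity_apply _ hA]
  rw [← lintegral_lintegral_swap]
  · refine lintegral_congr fun ω => ?_
    exact withDensity_apply _ hA
  · exact hjoint.mono_measure (Measure.prod_mono le_rfl Measure.restrict_le_self)

end mixture

/-! ### Distribution and density of the product. -/

theorem lemma1 {S : Type*} [MeasurableSpace S] (μ : Measure S) [IsProbabilityMeasure μ]
    (τ t : ℕ) (hτt : τ ≤ t)
    (Ω : ℕ → ℝ) (ℓ : ℝ → ℝ) (l : ℕ → ℝ) (φ : ℕ → S → ℝ)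
    (hΩ : ∀ i ∈ Finset.Icc τ t, 0 < Ω i)
    (hℓ : ∀ i ∈ Finset.Icc τ t, 0 < ℓ (l i))
    (hφ : ∀ i ∈ Finset.Icc τ t, HasLaw (φ i) (expMeasure (1 / ℓ (l i))) μ)
    (hind : iIndepFun (fun (i : Finset.Icc τ t) => φ i) μ)
    (ξ : S → ℝ) (hξ : ξ = fun ω => ∏ i ∈ Finset.Icc τ t, Ω i * φ i ω)
    (ξbar : ℝ) (hξbar : ξbar = ∏ i ∈ Finset.Icc τ t, Ω i * ℓ (l i))
    (a : Fin 0 → ℂ)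
    (b₁ : Fin (t - τ + 1) → ℂ)
    (hb₁ : b₁ = Fin.snoc (α := fun _ => ℂ) (fun _ : Fin (t - τ) => (1 : ℂ)) (0 : ℂ))
    (b₀ : Fin (t - τ + 1) → ℂ) (hb₀ : b₀ = fun _ => (0 : ℂ)) :
    -- the CDF of `ξ`
    (∀ x : ℝ, 0 < x →
      MeijerGWellDefined (t - τ + 1) 0 a b₁ ((x / ξbar : ℝ) : ℂ) ∧
      ((μ.real {ω | ξ ω < x} : ℝ) : ℂ) =
        1 - meijerG (t - τ + 1) 0 a b₁ ((x / ξbar : ℝ) : ℂ) ∧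
      ((cdf (μ.map ξ) x : ℝ) : ℂ) =
        1 - meijerG (t - τ + 1) 0 a b₁ ((x / ξbar : ℝ) : ℂ)) ∧
    (∀ x : ℝ, x ≤ 0 → μ.real {ω | ξ ω < x} = 0 ∧ cdf (μ.map ξ) x = 0) ∧
    -- the PDF of `ξ`
    (∀ x : ℝ, 0 < x → MeijerGWellDefined (t - τ + 1) 0 a b₀ ((x / ξbar : ℝ) : ℂ)) ∧
    (∃ f : ℝ → ℝ,
      (∀ x : ℝ, 0 < x →
        ((f x : ℝ) : ℂ) =
          1 / (ξbar : ℂ) * meijerG (t - τ + 1) 0 a b₀ ((x / ξbar : ℝ) : ℂ)) ∧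
      (∀ x : ℝ, x ≤ 0 → f x = 0) ∧
      (∀ x : ℝ, 0 ≤ f x) ∧
      HasPDF ξ μ volume ∧
      pdf ξ μ volume =ᵐ[volume] fun x => ENNReal.ofReal (f x)) := by
  have hlast : t ∈ Finset.Icc τ t := Finset.mem_Icc.2 ⟨hτt, le_rfl⟩
  let U : Finset.Icc τ t → S → ℝ := fun i ω => (ℓ (l i))⁻¹ * φ i ω
  have hU : ∀ i, HasLaw (U i) (expMeasure 1) μ := fun i => by
    have hi := hℓ i i.2
    have hmap : HasLaw (fun u : ℝ => (ℓ (l i))⁻¹ * u) (expMeasure 1) (expMeasure (1 / ℓ (l i))) := by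
      refine ⟨by fun_prop, ?_⟩
      rw [map_const_mul_expMeasure (inv_pos.2 hi) (one_div_pos.2 hi)]
      congr 1
      field_simp
    exact hmap.comp (hφ i i.2)
  have hindU : iIndepFun U μ := hind.comp (fun i u => (ℓ (l i))⁻¹ * u) fun i => by fun_prop
  have hUm : ∀ i, AEMeasurable (U i) μ := fun i => (hU i).aemeasurable
  -- The index `t` is split off; for `τ = t` the remaining product `V` is empty and equals `1`.
  let j : Finset.Icc τ t := ⟨t, hlast⟩
  let s : Finset (Finset.Icc τ t) := Finset.univ.erase j
  have hcard : s.card = t - τ := by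
    rw [Finset.card_erase_of_mem (Finset.mem_univ j), Finset.card_univ, Fintype.card_coe,
      Nat.card_Icc]
    omega
  set V : S → ℝ := fun ω => ∏ i ∈ s, U i ω with hV
  have hVm : AEMeasurable V μ := Finset.aemeasurable_fun_prod s fun i _ => hUm i
  have hVpos : ∀ᵐ ω ∂μ, 0 < V ω := ae_pos_prod_exp hU s
  have hξpos : 0 < ξbar := by
    rw [hξbar]
    exact Finset.prod_pos fun i hi => mul_pos (hΩ i hi) (hℓ i hi)
  have hξW : ξ = fun ω => (ξbar * V ω) * U j ω := by
    ext ω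
    have h1 : V ω * U j ω = ∏ i, U i ω := Finset.prod_erase_mul _ _ (Finset.mem_univ j)
    rw [mul_assoc, h1, hξ, hξbar]
    dsimp only
    rw [← Finset.prod_coe_sort (Finset.Icc τ t) fun i => Ω i * φ i ω,
      ← Finset.prod_coe_sort (Finset.Icc τ t) fun i => Ω i * ℓ (l i), ← Finset.prod_mul_distrib]
    refine Finset.prod_congr rfl fun i _ => ?_
    have := (hℓ i i.2).ne'
    simp only [U]
    field_simp
  have hVU : IndepFun V (U j) μ := by
    have hprod : V = ∏ i ∈ s, U i := by
      ext ω
      simp [hV]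
    rw [hprod]
    exact hindU.indepFun_finsetProd_of_notMem₀ hUm (Finset.notMem_erase j Finset.univ)
  have hWU : IndepFun (fun ω => ξbar * V ω) (U j) μ :=
    hVU.comp (φ := fun v => ξbar * v) (ψ := id) (by fun_prop) measurable_id
  have hWm : AEMeasurable (fun ω => ξbar * V ω) μ := hVm.const_mul _
  have hWpos : ∀ᵐ ω ∂μ, 0 < ξbar * V ω := hVpos.mono fun ω h => mul_pos hξpos h
  have hξm : AEMeasurable ξ μ := by
    rw [hξW]
    exact hWm.mul (hUm j)
  have := Measure.isProbabilityMeasure_map hξm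
  have hmeijer := fun (β : ℝ) (hβ : 0 ≤ β) (x : ℝ) (hx : 0 < x) =>
    meijerG_eq_integral (n := t - τ) hVm hVpos (fun r hr => integrable_prod_exp_rpow hU hindU s hr)
      (fun w hw => hcard ▸ integral_prod_exp_cpow hU hindU s hw) hβ a (div_pos hx hξpos)
  have hb₀' : b₀ = Fin.snoc (α := fun _ => ℂ) (fun _ : Fin (t - τ) => ((0 : ℝ) : ℂ)) (0 : ℂ) := by
    rw [hb₀]
    ext i
    induction i using Fin.lastCases <;> simp
  have hb₁' : b₁ = Fin.snoc (α := fun _ => ℂ) (fun _ : Fin (t - τ) => ((1 : ℝ) : ℂ)) (0 : ℂ) := by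
    rw [hb₁, Complex.ofReal_one]
  have hcdf := cdf_map_mul_exp hWm hWpos (hU j) hWU
  rw [← hξW] at hcdf
  have hcdf_pos : ∀ x : ℝ, 0 < x → ((cdf (μ.map ξ) x : ℝ) : ℂ) =
      1 - meijerG (t - τ + 1) 0 a b₁ ((x / ξbar : ℝ) : ℂ) := fun x hx => by
    rw [hb₁', (hmeijer 1 zero_le_one x hx).2, hcdf, if_pos hx.le]
    simp [div_div]
  have hcdf_nonpos : ∀ x : ℝ, x ≤ 0 → cdf (μ.map ξ) x = 0 := fun x hx => by
    rw [hcdf]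
    split_ifs with h
    -- Only `x = 0` remains, where the average of `exp(-x/W)` is `1`.
    · simp [le_antisymm hx h]
    · rfl
  let f : ℝ → ℝ := fun x =>
    if 0 < x then ∫ ω, (ξbar * V ω)⁻¹ * Real.exp (-(x / (ξbar * V ω))) ∂μ else 0
  obtain ⟨hfm, hfmap⟩ := map_mul_exp_eq_withDensity (f := f) hWm hWpos (hU j) hWU
    (fun x hx => if_pos hx) (fun x hx => if_neg hx.not_gt)
  rw [← hξW] at hfmap
  have hpdf : HasPDF ξ μ volume := hasPDF_of_map_eq_withDensity hξm _ hfm hfmap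
  have hlt : ∀ x : ℝ, μ.real {ω | ξ ω < x} = cdf (μ.map ξ) x := fun x => by
    have hIio : μ.real {ω | ξ ω < x} = (μ.map ξ).real (Set.Iio x) :=
      (map_measureReal_apply_of_aemeasurable hξm measurableSet_Iio).symm
    rw [hIio, cdf_eq_real]
    -- The law has a density, hence no atom at `x`, so strict and weak inequality give the same
    -- probability.
    exact measureReal_congr (hpdf.absolutelyContinuous.ae_le Iio_ae_eq_Iic)
  refine ⟨fun x hx => ⟨?_, ?_, hcdf_pos x hx⟩, fun x hx => ⟨?_, hcdf_nonpos x hx⟩, fun x hx => ?_,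
    f, fun x hx => ?_, fun x hx => if_neg hx.not_gt, fun x => ?_, hpdf,
    (pdf.eq_of_map_eq_withDensity _ hfm).1 hfmap⟩
  · rw [hb₁']
    exact (hmeijer 1 zero_le_one x hx).1
  · rw [hlt, hcdf_pos x hx]
  · rw [hlt, hcdf_nonpos x hx]
  · rw [hb₀']
    exact (hmeijer 0 le_rfl x hx).1
  · rw [hb₀', (hmeijer 0 le_rfl x hx).2, ← Complex.ofReal_one, ← Complex.ofReal_div,
      ← Complex.ofReal_mul, ← integral_const_mul]
    simp only [f, if_pos hx]
    congr 1
    refine integral_congr_ae ?_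
    filter_upwards [hVpos] with ω hω
    rw [zero_sub, Real.rpow_neg_one, div_div, mul_inv, one_div, mul_assoc]
  · simp only [f]
    split_ifs
    · refine integral_nonneg_of_ae ?_
      filter_upwards [hWpos] with ω hω
      exact mul_nonneg (inv_nonneg.2 hω.le) (Real.exp_pos _).le
    · exact le_rfl
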